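/- Let $(\mathcal E,\rho)$ be a metric space with its Borel $\sigma$-algebra, let $\lambda,\kappa,\mu\colon\mathcal E\to[0,\infty)$ be continuous, and let $(\Omega,\mathcal F,\mathbb P)$ be a probability space carrying the following independent objects: a stochastic process $J=(J(t))_{t\ge 0}$ with state space $\mathcal E$ and càdlàg paths; a standard (unit-rate) Poisson process $\overline Y$; and a sequence $\overline Z_1,\overline Z_2,\dots$ of independent standard exponential random variables. Put $\Lambda(t)=\int_0^t\lambda(J(s))\,ds$ and let $Y(t)=\overline Y(\Lambda(t))$ be the arrival process, with jump times $\tau_1,\tau_2,\dots$, where $\tau_k=\inf\{t\ge 0: Y(t)\ge k\}$ and $\inf\emptyset=\infty$. At time $0$ the system is empty, and job $k$ arrives at time $\tau_k$ with service requirement $Z_k=\overline Z_k/\kappa(J(\tau_k))$ if $\kappa(J(\tau_k))>0$ and $Z_k=\infty$ if $\kappa(J(\tau_k))=0$. Its server works at rate $\mu(J(r))$ at time $r$, and the job leaves when its requirement has been processed. The number of jobs in the system at time $t\ge 0$ is therefore $$M(t)=\sum_{k=1}^{\infty}\Bigl(\mathbf 1\{\tau_k\le t\}-\mathbf 1\{\tau_k\le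 t\}\,\mathbf 1\bigl\{Z_k\le \textstyle\int_{[\tau_k,t)}\mu(J(r))\,dr\bigr\}\Bigr).$$ Then for every $t\ge 0$, almost surely only finitely many $\tau_k$ are at most $t$, and $M(t)$ has a Poisson distribution with random parameter $$\phi_t(J)=\int_0^t\lambda(J(s))\exp\Bigl(-\kappa(J(s))\int_s^t\mu(J(r))\,dr\Bigr)\,ds .$$ That is, $M(t)$ and $\phi_t(J)$ are random variables; conditionally on $\sigma(J(s):s\ge 0)$, $M(t)$ is Poisson distributed with parameter $\phi_t(J)$; and consequently the law of $M(t)$ is the mixed Poisson law $$\mathbb P(M(t)=n)=\mathbb E\Bigl[e^{-\phi_t(J)}\frac{\phi_t(J)^n}{n!}\Bigr],\qquad n=0,1,2,\dots$$ -/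

import Mathlib

open MeasureTheory ProbabilityTheory Filter Topology Set
open scoped NNReal ENNReal

noncomputable section

namespace ModulatedQueue

/-- A function on `[0, ∞)` is càdlàg: right-continuous with left limits in `E`
(at `0` the left neighbourhood filter is trivial, so nothing is asked there). -/
def IsCadlag {E : Type*} [TopologicalSpace E] (f : ℝ≥0 → E) : Prop :=
  ∀ t : ℝ≥0, ContinuousWithinAt f (Ici t) t ∧ ∃ l : E, Tendsto f (𝓝[<] t) (𝓝 l)

/-- A standard (unit rate) Poisson process: a counting process started at `0` whose paths are
nondecreasing and right-continuous, with independent increments, the increment over `(s, t]`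
being Poisson distributed with mean `t - s`. -/
structure IsStandardPoissonProcess {Ω : Type*} [MeasurableSpace Ω]
    (N : ℝ≥0 → Ω → ℕ) (P : Measure Ω) : Prop where
  measurable : ∀ t, Measurable (N t)
  zero : ∀ ω, N 0 ω = 0
  mono : ∀ ω, Monotone fun t => N t ω
  rightCont : ∀ ω t, ContinuousWithinAt (fun s => N s ω) (Ici t) t
  indepIncrements : HasIndepIncrements N P
  law_increment : ∀ s t : ℝ≥0, s ≤ t →
    HasLaw (fun ω => N t ω - N s ω) (poissonMeasure (t - s)) P

/-- The `k`-th jump time (`k ≥ 1`) of a counting path `Y`: the first time at which at least `k`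
jumps have been counted, and `∞` if there is no such time. -/
def jumpTime (Y : ℝ≥0 → ℕ) (k : ℕ) : ℝ≥0∞ :=
  ⨅ (s : ℝ≥0) (_ : k ≤ Y s), (s : ℝ≥0∞)

section Paths

variable {E : Type*} (lam kap mu : E → ℝ≥0)

/-- The cumulative arrival rate `Λ(t) = ∫_0^t λ(f(s)) ds` along a path `f` of the background
process. -/
def cumulativeRate (f : ℝ≥0 → E) (t : ℝ≥0) : ℝ≥0 :=
  ⟨∫ s in (0 : ℝ)..t, (lam (f s.toNNReal) : ℝ),
    intervalIntegral.integral_nonneg t.2 fun _ _ => NNReal.coe_nonneg _⟩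

/-- The arrival counting path `Y(t) = Ybar(Λ(t))`. -/
def arrivals (f : ℝ≥0 → E) (Ybar : ℝ≥0 → ℕ) (t : ℝ≥0) : ℕ :=
  Ybar (cumulativeRate lam f t)

/-- The arrival time `τ_k` of job `k ≥ 1`, the `k`-th jump time of the arrival path. -/
def arrivalTime (f : ℝ≥0 → E) (Ybar : ℝ≥0 → ℕ) (k : ℕ) : ℝ≥0∞ :=
  jumpTime (arrivals lam f Ybar) k

/-- The service requirement of a job that arrives while the background process is in state `x`,
given its standard exponential draw `z`: it is `z / κ(x)` if `κ(x) > 0`, and `∞` otherwise. -/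
def serviceRequirement (x : E) (z : ℝ) : EReal :=
  if 0 < kap x then ((z / (kap x : ℝ) : ℝ) : EReal) else ⊤

/-- The work `∫_{[s,t)} μ(f(r)) dr` that a server performs during `[s, t)`. -/
def workDone (f : ℝ≥0 → E) (s t : ℝ≥0) : ℝ :=
  ∫ r in Ico (s : ℝ) (t : ℝ), (mu (f r.toNNReal) : ℝ)

/-- Job `k` has entered the system at or before time `t`. -/
def HasEntered (f : ℝ≥0 → E) (Ybar : ℝ≥0 → ℕ) (t : ℝ≥0) (k : ℕ) : Prop :=
  arrivalTime lam f Ybar k ≤ t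

/-- Job `k` has both entered and left the system by time `t`: `τ_k ≤ t` and its service
requirement is at most the work performed during `[τ_k, t)`. -/
def HasLeft (f : ℝ≥0 → E) (Ybar : ℝ≥0 → ℕ) (Zbar : ℕ → ℝ) (t : ℝ≥0) (k : ℕ) : Prop :=
  arrivalTime lam f Ybar k ≤ t ∧
    serviceRequirement kap (f (arrivalTime lam f Ybar k).toNNReal) (Zbar k) ≤
      ((workDone mu f (arrivalTime lam f Ybar k).toNNReal t : ℝ) : EReal)

open Classical in
/-- The number of jobs in the system at time `t`, starting empty, with jobs numbered
`k = 1, 2, …`: the sum over all jobs of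
`1{entered by time t} - 1{entered and left by time t}`. -/
def numJobs (f : ℝ≥0 → E) (Ybar : ℝ≥0 → ℕ) (Zbar : ℕ → ℝ) (t : ℝ≥0) : ℕ :=
  ∑' k : ℕ, ((if HasEntered lam f Ybar t (k + 1) then 1 else 0) -
    (if HasLeft lam kap mu f Ybar Zbar t (k + 1) then 1 else 0))

/-- The parameter `φ_t(f) = ∫_0^t λ(f(s)) exp(-κ(f(s)) ∫_s^t μ(f(r)) dr) ds`. -/
def poissonParameter (t : ℝ≥0) (f : ℝ≥0 → E) : ℝ≥0 :=
  ⟨∫ s in (0 : ℝ)..t, (lam (f s.toNNReal) : ℝ) *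
      Real.exp (-(kap (f s.toNNReal) : ℝ) * ∫ r in s..t, (mu (f r.toNNReal) : ℝ)),
    intervalIntegral.integral_nonneg t.2 fun _ _ =>
      mul_nonneg (NNReal.coe_nonneg _) (Real.exp_pos _).le⟩

end Paths

end ModulatedQueue

end

noncomputable section

namespace ModulatedQueue

/-!
Freeze the background path. The arrivals then form a Poisson process with intensity `λ(J(s)) ds`,
and a job that arrives at time `s ≤ t` is still present at time `t` with probability
`exp (-κ(J(s)) ∫_s^t μ(J(r)) dr)`, independently of the other jobs. So `M(t)` counts the points of
an independently thinned Poisson process, which is Poisson with parameter `φ_t(J)`. Since `J` is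
independent of the rest of the randomness, the law along a frozen path is the conditional law.

Integrating out the exponential draws turns the generating function of `M(t)` into the generating
functional `E ∏ h(τ_k)` of the arrivals, where `h(s)` is the generating function of the indicator
that a job arriving at time `s` is present. Rounding the arrival times up to a grid reduces this
functional to independent Poisson increments, and right-continuity of `h` justifies the limit.
-/

/-! ### Right-continuous functions -/

/-- Right-continuity of a function on `[0, ∞)`, the property shared by càdlàg paths and counting
paths. -/
def IsRightCont {E : Type*} [TopologicalSpace E] (f : ℝ≥0 → E) : Prop :=
  ∀ t, ContinuousWithinAt f (Ici t) t

/-- `s` rounded up to the grid `δ ℕ`, used to approximate right-continuous functions by step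
functions. Only meaningful for `δ > 0`. -/
def gridCeil (δ s : ℝ≥0) : ℝ≥0 := ⌈s / δ⌉₊ * δ

theorem le_gridCeil {δ : ℝ≥0} (hδ : 0 < δ) (s : ℝ≥0) : s ≤ gridCeil δ s :=
  (div_le_iff₀ hδ).1 (Nat.le_ceil _)

theorem gridCeil_le_add {δ : ℝ≥0} (hδ : 0 < δ) (s : ℝ≥0) : gridCeil δ s ≤ s + δ :=
  calc gridCeil δ s ≤ (s / δ + 1) * δ := by
        unfold gridCeil
        gcongr
        exact (Nat.ceil_lt_add_one zero_le).le
    _ = s + δ := by rw [add_mul, div_mul_cancel₀ _ hδ.ne', one_mul]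

theorem gridCeil_eq_of_mem_Ioc {δ : ℝ≥0} (hδ : 0 < δ) {i : ℕ} {s : ℝ≥0}
    (hs : s ∈ Ioc (i * δ) ((i + 1 : ℕ) * δ)) : gridCeil δ s = (i + 1 : ℕ) * δ := by
  rw [gridCeil, (Nat.ceil_eq_iff i.succ_ne_zero).2
    ⟨by simpa using (lt_div_iff₀ hδ).2 hs.1, (div_le_iff₀ hδ).2 hs.2⟩]

theorem measurable_gridCeil (δ : ℝ≥0) : Measurable (gridCeil δ) :=
  (measurable_from_nat (f := fun k : ℕ => (k : ℝ≥0) * δ)).comp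
    (Nat.measurable_ceil.comp (measurable_id.div_const δ))

theorem tendsto_gridCeil {c : ℝ≥0} (hc : 0 < c) (s : ℝ≥0) :
    Tendsto (fun n : ℕ => gridCeil (c / (n + 1)) s) atTop (𝓝[≥] s) := by
  have hδ (n : ℕ) : 0 < c / ((n : ℝ≥0) + 1) := by positivity
  have hupper : Tendsto (fun n : ℕ => s + c / ((n : ℝ≥0) + 1)) atTop (𝓝 s) := by
    simpa [div_eq_mul_inv] using
      ((tendsto_one_div_add_atTop_nhds_zero_nat (𝕜 := ℝ≥0)).const_mul c).const_add s
  exact tendsto_nhdsWithin_iff.2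
    ⟨tendsto_of_tendsto_of_tendsto_of_le_of_le tendsto_const_nhds hupper
      (fun n => le_gridCeil (hδ n) s) (fun n => gridCeil_le_add (hδ n) s),
    .of_forall fun n => le_gridCeil (hδ n) s⟩

section Measurability

variable {β : Type*} [TopologicalSpace β] [TopologicalSpace.PseudoMetrizableSpace β]
  [MeasurableSpace β] [BorelSpace β]

theorem measurable_uncurry_of_isRightCont {Ω : Type*} [MeasurableSpace Ω]
    {X : ℝ≥0 → Ω → β} (hX : ∀ t, Measurable (X t)) (hc : ∀ ω, IsRightCont fun s => X s ω) :
    Measurable (fun q : ℝ≥0 × Ω => X q.1 q.2) := by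
  refine measurable_of_tendsto_metrizable
    (f := fun (n : ℕ) (q : ℝ≥0 × Ω) => X (gridCeil (1 / (n + 1)) q.1) q.2) (fun n => ?_)
    (tendsto_pi_nhds.2 fun q => (hc q.2 q.1).tendsto.comp (tendsto_gridCeil one_pos q.1))
  have h : Measurable (fun q : ℕ × Ω => X (q.1 * (1 / (n + 1))) q.2) :=
    measurable_from_prod_countable_right fun k => hX (k * (1 / (n + 1)))
  exact h.comp ((Nat.measurable_ceil.comp (measurable_fst.div_const _)).prodMk measurable_snd)

theorem IsRightCont.measurable {f : ℝ≥0 → β} (hf : IsRightCont f) : Measurable f :=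
  (measurable_uncurry_of_isRightCont (X := fun t (_ : Unit) => f t) (fun _ => measurable_const)
    fun _ => hf).comp (measurable_prodMk_right (y := ()))

end Measurability

theorem IsCadlag.isRightCont {E : Type*} [TopologicalSpace E] {f : ℝ≥0 → E} (hf : IsCadlag f) :
    IsRightCont f :=
  fun t => (hf t).1

theorem IsCadlag.comp {E F : Type*} [TopologicalSpace E] [TopologicalSpace F] {f : ℝ≥0 → E}
    (hf : IsCadlag f) {g : E → F} (hg : Continuous g) : IsCadlag fun s => g (f s) := fun t =>
  ⟨hg.continuousAt.comp_continuousWithinAt (hf t).1,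
    (hf t).2.elim fun l hl => ⟨g l, (hg.tendsto l).comp hl⟩⟩

theorem IsCadlag.isBoundedUnder_norm {F : Type*} [SeminormedAddCommGroup F] {f : ℝ≥0 → F}
    (hf : IsCadlag f) (t : ℝ≥0) : (𝓝 t).IsBoundedUnder (· ≤ ·) (fun s => ‖f s‖) := by
  obtain ⟨hright, l, hleft⟩ := hf t
  obtain ⟨b, hb⟩ := hleft.norm.isBoundedUnder_le
  obtain ⟨c, hc⟩ := hright.tendsto.norm.isBoundedUnder_le
  refine ⟨max b c, ?_⟩
  rw [← nhdsLT_sup_nhdsGE, Filter.map_sup, eventually_sup]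
  exact ⟨hb.mono fun _ h => h.trans (le_max_left _ _),
    hc.mono fun _ h => h.trans (le_max_right _ _)⟩

theorem IsCadlag.locallyIntegrable {F : Type*} [NormedAddCommGroup F] [MeasurableSpace F]
    [BorelSpace F] [SecondCountableTopology F] {f : ℝ≥0 → F} (hf : IsCadlag f)
    (ν : Measure ℝ≥0) [IsLocallyFiniteMeasure ν] : LocallyIntegrable f ν := fun t =>
  (ν.finiteAt_nhds t).integrableAtFilter
    hf.isRightCont.measurable.stronglyMeasurable.stronglyMeasurableAtFilter
    (hf.isBoundedUnder_norm t)

/-! ### Counting paths -/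

/-- A path of a counting process: it starts at `0`, is nondecreasing and right-continuous. Jumps of
size larger than `1` are allowed. -/
structure IsCountingPath (Y : ℝ≥0 → ℕ) : Prop where
  zero : Y 0 = 0
  mono : Monotone Y
  rightCont : IsRightCont Y

/-- The time of the jump of `Y` that takes the count above `k`, so that epochs are numbered from
`0`. The junk value is `0` if the count never exceeds `k`. -/
def epoch (Y : ℝ≥0 → ℕ) (k : ℕ) : ℝ≥0 := (jumpTime Y (k + 1)).toNNReal

namespace IsCountingPath

variable {Y : ℝ≥0 → ℕ}

theorem comp (hY : IsCountingPath Y) {a : ℝ≥0 → ℝ≥0} (ha_zero : a 0 = 0) (ha_mono : Monotone a)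
    (ha : IsRightCont a) : IsCountingPath fun t => Y (a t) where
  zero := by rw [ha_zero, hY.zero]
  mono := hY.mono.comp ha_mono
  rightCont t := (hY.rightCont (a t)).comp (ha t) fun _ hs => ha_mono hs

theorem jumpTime_le_iff (hY : IsCountingPath Y) {k : ℕ} {t : ℝ≥0} :
    jumpTime Y k ≤ t ↔ k ≤ Y t := by
  refine ⟨fun h => ?_, fun h => iInf₂_le t h⟩
  by_contra! hk
  obtain ⟨u, htu, hu⟩ : ∃ u > t, Ico t u ⊆ {s | Y s < k} :=
    mem_nhdsGE_iff_exists_Ico_subset.1 ((hY.rightCont t).eventually_lt_const hk)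
  have hu_le : (u : ℝ≥0∞) ≤ jumpTime Y k := by
    refine le_iInf₂ fun s hs => ENNReal.coe_le_coe.2 ?_
    by_contra! hsu
    rcases le_total t s with hts | hst
    · exact (hu ⟨hts, hsu⟩).not_ge hs
    · exact hk.not_ge (hs.trans (hY.mono hst))
  exact (ENNReal.coe_lt_coe.2 htu).not_ge (hu_le.trans h)

theorem epoch_le_iff (hY : IsCountingPath Y) {k : ℕ} {t : ℝ≥0} (hk : k < Y t) {s : ℝ≥0} :
    epoch Y k ≤ s ↔ k < Y s := by
  have hfin : jumpTime Y (k + 1) ≠ ∞ :=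
    ((hY.jumpTime_le_iff.2 hk).trans_lt ENNReal.coe_lt_top).ne
  rw [epoch, ← ENNReal.coe_le_coe, ENNReal.coe_toNNReal hfin, hY.jumpTime_le_iff, Nat.succ_le_iff]

theorem prod_gridCeil_epoch {M : Type*} [CommMonoid M] (hY : IsCountingPath Y) {δ : ℝ≥0}
    (hδ : 0 < δ) (h : ℝ≥0 → M) (m : ℕ) :
    ∏ k ∈ Finset.range (Y (m * δ)), h (gridCeil δ (epoch Y k)) =
      ∏ i ∈ Finset.range m, h ((i + 1 : ℕ) * δ) ^ (Y ((i + 1 : ℕ) * δ) - Y (i * δ)) := by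
  induction m with
  | zero => simp [hY.zero]
  | succ m ih =>
    have hle : Y (m * δ) ≤ Y ((m + 1 : ℕ) * δ) := hY.mono (by gcongr; simp)
    rw [Finset.prod_range_succ, ← ih, ← Finset.prod_range_mul_prod_Ico _ hle, ← Nat.card_Ico]
    congr 1
    refine Finset.prod_eq_pow_card fun k hk => ?_
    obtain ⟨hk_ge, hk_lt⟩ := Finset.mem_Ico.1 hk
    have hepoch_gt : m * δ < epoch Y k := by
      rw [← not_le, hY.epoch_le_iff hk_lt, not_lt]
      exact hk_ge
    rw [gridCeil_eq_of_mem_Ioc hδ ⟨hepoch_gt, (hY.epoch_le_iff hk_lt).2 hk_lt⟩]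

end IsCountingPath

theorem measurable_epoch {Ω : Type*} [MeasurableSpace Ω] {N : ℝ≥0 → Ω → ℕ}
    (hN : ∀ t, Measurable (N t)) (hc : ∀ ω, IsCountingPath fun t => N t ω) (k : ℕ) :
    Measurable fun ω => epoch (fun t => N t ω) k := by
  refine ENNReal.measurable_toNNReal.comp (measurable_of_Iic fun x => ?_)
  induction x with
  | top => simp
  | coe s =>
    simpa only [preimage, mem_Iic, (hc _).jumpTime_le_iff] using
      measurableSet_le measurable_const (hN s)

/-! ### Poisson processes -/

/-- A Poisson process on `(0, ∞)` with intensity measure `ν`. The law of the increments is the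
intended one only if `ν` is finite on bounded intervals. -/
structure IsPoissonProcess {Ω : Type*} [MeasurableSpace Ω] (N : ℝ≥0 → Ω → ℕ) (ν : Measure ℝ≥0)
    (P : Measure Ω) : Prop where
  measurable : ∀ t, Measurable (N t)
  isCountingPath : ∀ ω, IsCountingPath fun t => N t ω
  indepIncrements : HasIndepIncrements N P
  law_increment : ∀ s t : ℝ≥0, s ≤ t →
    HasLaw (fun ω => N t ω - N s ω) (poissonMeasure (ν (Ioc s t)).toNNReal) P

/-- The cumulative distribution function of a measure on `[0, ∞)` that is finite on bounded
intervals. The mass of `{0}` is disregarded. -/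
def cumulative (ν : Measure ℝ≥0) (t : ℝ≥0) : ℝ≥0 := (ν (Ioc 0 t)).toNNReal

section Cumulative

variable (ν : Measure ℝ≥0) [IsLocallyFiniteMeasure ν]

theorem monotone_cumulative : Monotone (cumulative ν) := fun _ _ hst =>
  ENNReal.toNNReal_mono measure_Ioc_lt_top.ne (measure_mono (Ioc_subset_Ioc_right hst))

theorem cumulative_sub (s t : ℝ≥0) :
    cumulative ν t - cumulative ν s = (ν (Ioc s t)).toNNReal := by
  rcases le_total s t with hst | hts
  · have hsplit : cumulative ν t = cumulative ν s + (ν (Ioc s t)).toNNReal := by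
      rw [cumulative, cumulative,
        ← ENNReal.toNNReal_add measure_Ioc_lt_top.ne measure_Ioc_lt_top.ne,
        ← measure_union (Ioc_disjoint_Ioc_of_le le_rfl) measurableSet_Ioc,
        Ioc_union_Ioc_eq_Ioc zero_le hst]
    rw [hsplit, add_tsub_cancel_left]
  · rw [tsub_eq_zero_of_le (monotone_cumulative ν hts), Ioc_eq_empty hts.not_gt, measure_empty,
      ENNReal.toNNReal_zero]

theorem isRightCont_cumulative : IsRightCont (cumulative ν) := fun t => by
  rw [← continuousWithinAt_Ioi_iff_Ici]
  have hinter : Ioc 0 t = ⋂ s > t, Ioc 0 s := by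
    ext x
    simp only [mem_iInter, mem_Ioc]
    exact ⟨fun hx s hs => ⟨hx.1, hx.2.trans hs.le⟩,
      fun hx => ⟨(hx (t + 1) (lt_add_one t)).1, le_of_forall_gt_imp_ge_of_dense fun s hs =>
        (hx s hs).2⟩⟩
  refine (ENNReal.tendsto_toNNReal measure_Ioc_lt_top.ne).comp ?_
  rw [hinter]
  exact tendsto_measure_biInter_gt (fun _ _ => measurableSet_Ioc.nullMeasurableSet)
    (fun _ _ _ hij => Ioc_subset_Ioc_right hij)
    ⟨t + 1, lt_add_one t, measure_Ioc_lt_top.ne⟩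

end Cumulative

theorem IsStandardPoissonProcess.isCountingPath {Ω : Type*} [MeasurableSpace Ω] {N : ℝ≥0 → Ω → ℕ}
    {P : Measure Ω} (hN : IsStandardPoissonProcess N P) (ω : Ω) :
    IsCountingPath fun t => N t ω :=
  ⟨hN.zero ω, hN.mono ω, hN.rightCont ω⟩

theorem IsStandardPoissonProcess.isPoissonProcess_comp_cumulative {Ω : Type*} [MeasurableSpace Ω]
    {N : ℝ≥0 → Ω → ℕ} {P : Measure Ω} (hN : IsStandardPoissonProcess N P) (ν : Measure ℝ≥0)
    [IsLocallyFiniteMeasure ν] : IsPoissonProcess (fun t => N (cumulative ν t)) ν P where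
  measurable _ := hN.measurable _
  isCountingPath ω := (hN.isCountingPath ω).comp (by simp [cumulative]) (monotone_cumulative ν)
    (isRightCont_cumulative ν)
  indepIncrements n _ ht := hN.indepIncrements n _ ((monotone_cumulative ν).comp ht)
  law_increment s t hst := by
    rw [← cumulative_sub ν]
    exact hN.law_increment _ _ (monotone_cumulative ν hst)
/-! ### The generating functional of a Poisson process -/

theorem integral_pow_poissonMeasure (r : ℝ≥0) (z : ℂ) :
    ∫ n, z ^ n ∂(poissonMeasure r) = Complex.exp (r * (z - 1)) := by
  rw [integral_poissonMeasure]
  calc ∑' n : ℕ, (Real.exp (-r) * r ^ n / n.factorial) • z ^ n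
      = ∑' n : ℕ, (Real.exp (-r) : ℂ) * ((r * z) ^ n / n.factorial) := by
        refine tsum_congr fun n => ?_
        rw [Complex.real_smul, mul_pow]
        push_cast
        ring
    _ = Real.exp (-r) * Complex.exp (r * z) := by
        rw [tsum_mul_left, (NormedSpace.expSeries_div_hasSum_exp ((r : ℂ) * z)).tsum_eq,
          Complex.exp_eq_exp_ℂ]
    _ = Complex.exp (r * (z - 1)) := by
        rw [Complex.ofReal_exp, ← Complex.exp_add]
        push_cast
        ring_nf

theorem integral_prod_range_of_iIndepFun {Ω α 𝕜 : Type*} [MeasurableSpace Ω] [MeasurableSpace α]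
    [RCLike 𝕜] {P : Measure Ω} {X : ℕ → Ω → α} (hX : iIndepFun X P)
    (hX_meas : ∀ k, Measurable (X k))
    {f : ℕ → α → 𝕜} (hf : ∀ k, Measurable (f k)) (n : ℕ) :
    ∫ ω, ∏ k ∈ Finset.range n, f k (X k ω) ∂P = ∏ k ∈ Finset.range n, ∫ ω, f k (X k ω) ∂P := by
  simp_rw [Finset.prod_range]
  exact (hX.precomp Fin.val_injective).integral_fun_prod_comp
    (f := fun i : Fin n => f i) (fun _ => (hX_meas _).aemeasurable)
    (fun _ => (hf _).aestronglyMeasurable)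

theorem measurable_comp_nat {Ω β : Type*} [MeasurableSpace Ω] [MeasurableSpace β] {n : Ω → ℕ}
    (hn : Measurable n) {F : ℕ → Ω → β} (hF : ∀ k, Measurable (F k)) :
    Measurable fun ω => F (n ω) ω :=
  (measurable_from_prod_countable_right (f := fun q : ℕ × Ω => F q.1 q.2) hF).comp
    (hn.prodMk measurable_id)

theorem setIntegral_comp_gridCeil {F : Type*} [NormedAddCommGroup F] [NormedSpace ℝ F]
    [CompleteSpace F] (ν : Measure ℝ≥0) [IsLocallyFiniteMeasure ν] {δ : ℝ≥0} (hδ : 0 < δ)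
    (G : ℝ≥0 → F) (m : ℕ) :
    ∫ s in Ioc 0 (m * δ), G (gridCeil δ s) ∂ν =
      ∑ i ∈ Finset.range m, ν.real (Ioc (i * δ) ((i + 1 : ℕ) * δ)) • G ((i + 1 : ℕ) * δ) := by
  have hmono : Monotone fun i : ℕ => (i : ℝ≥0) * δ := fun i j hij => by dsimp only; gcongr
  have hconst (i : ℕ) : EqOn (fun s => G (gridCeil δ s)) (fun _ => G ((i + 1 : ℕ) * δ))
      (Ioc (i * δ) ((i + 1 : ℕ) * δ)) := fun s hs => by
    simp only [gridCeil_eq_of_mem_Ioc hδ hs]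
  have hcells : Ioc 0 (m * δ) = ⋃ i ∈ Finset.range m, Ioc (i * δ) ((i + 1 : ℕ) * δ) := by
    simpa using (hmono.biUnion_Ico_Ioc_map_succ 0 m).symm
  have hdisj : Pairwise (Function.onFun Disjoint
      fun i : ℕ => Ioc (i * δ) ((i + 1 : ℕ) * δ)) :=
    hmono.pairwise_disjoint_on_Ioc_succ
  rw [hcells, integral_biUnion_finset _ (fun _ _ => measurableSet_Ioc) (hdisj.set_pairwise _)
    fun i _ => (integrableOn_congr_fun (hconst i) measurableSet_Ioc).2
      (integrableOn_const measure_Ioc_lt_top.ne)]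
  exact Finset.sum_congr rfl fun i _ => by
    rw [setIntegral_congr_fun measurableSet_Ioc (hconst i), setIntegral_const]

theorem tendsto_setIntegral_comp_gridCeil {F : Type*} [NormedAddCommGroup F] [NormedSpace ℝ F]
    [MeasurableSpace F] [BorelSpace F] [SecondCountableTopology F] {ν : Measure ℝ≥0} {G : ℝ≥0 → F}
    (hG : IsRightCont G) {C : ℝ} (hG_le : ∀ s, ‖G s‖ ≤ C) {c : ℝ≥0} (hc : 0 < c) {A : Set ℝ≥0}
    (hA : ν A < ∞) :
    Tendsto (fun n : ℕ => ∫ s in A, G (gridCeil (c / (n + 1)) s) ∂ν) atTop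
      (𝓝 (∫ s in A, G s ∂ν)) :=
  tendsto_integral_of_dominated_convergence (fun _ => C)
    (fun _ => (hG.measurable.comp (measurable_gridCeil _)).aestronglyMeasurable)
    (integrableOn_const hA.ne) (fun _ => .of_forall fun _ => hG_le _)
    (.of_forall fun s => (hG s).tendsto.comp (tendsto_gridCeil hc s))

namespace IsPoissonProcess

variable {Ω : Type*} [MeasurableSpace Ω] {P : Measure Ω} {N : ℝ≥0 → Ω → ℕ} {ν : Measure ℝ≥0}

theorem integral_pow_increment (hN : IsPoissonProcess N ν P) {s t : ℝ≥0} (hst : s ≤ t) (z : ℂ) :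
    ∫ ω, z ^ (N t ω - N s ω) ∂P = Complex.exp (ν.real (Ioc s t) * (z - 1)) :=
  ((hN.law_increment s t hst).integral_comp (f := fun n => z ^ n)
    measurable_from_nat.aestronglyMeasurable).trans (integral_pow_poissonMeasure _ z)

theorem isProbabilityMeasure (hN : IsPoissonProcess N ν P) : IsProbabilityMeasure P :=
  (hN.law_increment 0 0 le_rfl).isProbabilityMeasure

theorem tendsto_integral_prod_gridCeil_epoch (hN : IsPoissonProcess N ν P) {h : ℝ≥0 → ℂ}
    (hh : IsRightCont h) (hh_le : ∀ s, ‖h s‖ ≤ 1) {c : ℝ≥0} (hc : 0 < c) (t : ℝ≥0) :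
    Tendsto (fun n : ℕ => ∫ ω, ∏ k ∈ Finset.range (N t ω),
        h (gridCeil (c / (n + 1)) (epoch (fun s => N s ω) k)) ∂P) atTop
      (𝓝 (∫ ω, ∏ k ∈ Finset.range (N t ω), h (epoch (fun s => N s ω) k) ∂P)) := by
  have := hN.isProbabilityMeasure
  refine tendsto_integral_of_dominated_convergence (fun _ => 1) (fun n => ?_)
    (integrable_const _) (fun n => .of_forall fun ω => ?_) (.of_forall fun ω => ?_)
  · have hterm (k : ℕ) :
        Measurable fun ω => h (gridCeil (c / (n + 1)) (epoch (fun s => N s ω) k)) :=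
      hh.measurable.comp
        ((measurable_gridCeil _).comp (measurable_epoch hN.measurable hN.isCountingPath k))
    exact (measurable_comp_nat (hN.measurable t) fun m =>
      Finset.measurable_fun_prod (Finset.range m) fun k _ => hterm k).aestronglyMeasurable
  · rw [norm_prod]
    exact Finset.prod_le_one (fun _ _ => norm_nonneg _) fun _ _ => hh_le _
  · exact tendsto_finsetProd _ fun k _ => (hh _).tendsto.comp (tendsto_gridCeil hc _)

variable [IsLocallyFiniteMeasure ν]

theorem integral_prod_gridCeil_epoch (hN : IsPoissonProcess N ν P) {δ : ℝ≥0} (hδ : 0 < δ)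
    (h : ℝ≥0 → ℂ) (m : ℕ) :
    ∫ ω, ∏ k ∈ Finset.range (N (m * δ) ω), h (gridCeil δ (epoch (fun s => N s ω) k)) ∂P =
      Complex.exp (∫ s in Ioc 0 (m * δ), (h (gridCeil δ s) - 1) ∂ν) := by
  have hmono : Monotone fun i : ℕ => (i : ℝ≥0) * δ := fun i j hij => by dsimp only; gcongr
  calc ∫ ω, ∏ k ∈ Finset.range (N (m * δ) ω), h (gridCeil δ (epoch (fun s => N s ω) k)) ∂P
      = ∫ ω, ∏ i ∈ Finset.range m,
          h ((i + 1 : ℕ) * δ) ^ (N ((i + 1 : ℕ) * δ) ω - N (i * δ) ω) ∂P := by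
        simp_rw [fun ω => (hN.isCountingPath ω).prod_gridCeil_epoch hδ h m]
    _ = ∏ i ∈ Finset.range m,
          ∫ ω, h ((i + 1 : ℕ) * δ) ^ (N ((i + 1 : ℕ) * δ) ω - N (i * δ) ω) ∂P :=
        integral_prod_range_of_iIndepFun (f := fun i n => h ((i + 1 : ℕ) * δ) ^ n)
          (hN.indepIncrements.nat hmono) (fun _ => (hN.measurable _).sub (hN.measurable _))
          (fun _ => measurable_from_nat) m
    _ = ∏ i ∈ Finset.range m, Complex.exp
          (ν.real (Ioc (i * δ) ((i + 1 : ℕ) * δ)) • (h ((i + 1 : ℕ) * δ) - 1)) :=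
        Finset.prod_congr rfl fun i _ => hN.integral_pow_increment (hmono i.le_succ) _
    _ = Complex.exp (∫ s in Ioc 0 (m * δ), (h (gridCeil δ s) - 1) ∂ν) := by
        rw [← Complex.exp_sum, setIntegral_comp_gridCeil ν hδ (fun s => h s - 1)]

theorem integral_prod_epoch (hN : IsPoissonProcess N ν P) {h : ℝ≥0 → ℂ}
    (hh : IsRightCont h) (hh_le : ∀ s, ‖h s‖ ≤ 1) (t : ℝ≥0) :
    ∫ ω, ∏ k ∈ Finset.range (N t ω), h (epoch (fun s => N s ω) k) ∂P =
      Complex.exp (∫ s in Ioc 0 t, (h s - 1) ∂ν) := by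
  rcases eq_zero_or_pos t with rfl | ht
  · have := hN.isProbabilityMeasure
    simp [fun ω => (hN.isCountingPath ω).zero]
  refine tendsto_nhds_unique (hN.tendsto_integral_prod_gridCeil_epoch hh hh_le ht t)
    (((tendsto_setIntegral_comp_gridCeil (G := fun s => h s - 1) (C := 2)
      (fun s => (hh s).sub continuousWithinAt_const) (fun s => ?_) ht
      measure_Ioc_lt_top).cexp).congr fun n => ?_)
  · calc ‖h s - 1‖ ≤ ‖h s‖ + ‖(1 : ℂ)‖ := norm_sub_le _ _
      _ ≤ 2 := by rw [norm_one]; linarith [hh_le s]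
  · have hgrid : ((n + 1 : ℕ) : ℝ≥0) * (t / (n + 1)) = t := by
      push_cast
      field_simp
    simpa only [hgrid] using
      (hN.integral_prod_gridCeil_epoch (δ := t / (n + 1)) (by positivity) h (n + 1)).symm

end IsPoissonProcess

/-! ### Thinning of a Poisson process -/

theorem integral_comp_prodMk_of_indepFun {Ω α β F : Type*} [MeasurableSpace Ω] [MeasurableSpace α]
    [MeasurableSpace β] [NormedAddCommGroup F] [NormedSpace ℝ F] {P : Measure Ω} [IsFiniteMeasure P]
    {X : Ω → α} {W : Ω → β} (hX : Measurable X) (hW : Measurable W) (hXW : IndepFun X W P)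
    {G : α × β → F} (hG : StronglyMeasurable G)
    (hG_int : Integrable G ((P.map X).prod (P.map W))) :
    ∫ ω, G (X ω, W ω) ∂P = ∫ ω, ∫ ω', G (X ω, W ω') ∂P ∂P :=
  calc ∫ ω, G (X ω, W ω) ∂P
      = ∫ q, G q ∂(P.map fun ω => (X ω, W ω)) :=
        (integral_map (hX.prodMk hW).aemeasurable hG.aestronglyMeasurable).symm
    _ = ∫ x, ∫ w, G (x, w) ∂(P.map W) ∂(P.map X) := by
        rw [hXW.map_prod_eq_prod_map_map hX.aemeasurable hW.aemeasurable, integral_prod _ hG_int]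
    _ = ∫ ω, ∫ w, G (X ω, w) ∂(P.map W) ∂P :=
        integral_map hX.aemeasurable hG.integral_prod_right'.aestronglyMeasurable
    _ = ∫ ω, ∫ ω', G (X ω, W ω') ∂P ∂P := by
        refine integral_congr_ae (.of_forall fun ω => ?_)
        exact integral_map hW.aemeasurable
          (hG.comp_measurable measurable_prodMk_left).aestronglyMeasurable

theorem comap_subtype_mk {Ω α : Type*} [MeasurableSpace α] {p : α → Prop} {X : Ω → α}
    (hX : ∀ ω, p (X ω)) :
    MeasurableSpace.comap (fun ω => (⟨X ω, hX ω⟩ : Subtype p)) inferInstance =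
      MeasurableSpace.comap X inferInstance :=
  MeasurableSpace.comap_comp

theorem indepFun_subtype_mk {Ω α β : Type*} [MeasurableSpace Ω] [MeasurableSpace α]
    [MeasurableSpace β] {P : Measure Ω} {p : α → Prop} {X : Ω → α} {W : Ω → β}
    (hXW : IndepFun X W P) (hX : ∀ ω, p (X ω)) :
    IndepFun (fun ω => (⟨X ω, hX ω⟩ : Subtype p)) W P := by
  rw [IndepFun_iff_Indep] at hXW ⊢
  rwa [comap_subtype_mk]

section Count

variable {Ω : Type*} [MeasurableSpace Ω] {P : Measure Ω}

open Classical in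
theorem measurable_count {A : ℕ → Set Ω} (hA : ∀ k, MeasurableSet (A k)) {n : Ω → ℕ}
    (hn : Measurable n) : Measurable fun ω => Nat.count (fun k => ω ∈ A k) (n ω) := by
  refine measurable_comp_nat (F := fun m ω => Nat.count (fun k => ω ∈ A k) m) hn fun m => ?_
  induction m with
  | zero => simp
  | succ m ih =>
    simp only [Nat.count_succ]
    exact ih.add (Measurable.ite (hA m) measurable_const measurable_const)

open Classical in
theorem integral_ite_mem [IsProbabilityMeasure P] {A : Set Ω} (hA : MeasurableSet A) (u : ℂ) :
    ∫ ω, (if ω ∈ A then u else 1) ∂P = 1 + (u - 1) * P.real A := by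
  have hindicator (ω : Ω) : (if ω ∈ A then u else 1) = 1 + A.indicator (fun _ => u - 1) ω := by
    by_cases hω : ω ∈ A <;> simp [hω]
  simp_rw [hindicator]
  rw [integral_add (integrable_const _) ((integrable_const _).indicator hA),
    integral_indicator_const _ hA, integral_const, probReal_univ, one_smul, Complex.real_smul,
    mul_comm]

open Classical in
theorem integral_pow_count {α : Type*} [MeasurableSpace α] {ξ : ℕ → Ω → α}
    (hξ : iIndepFun ξ P) (hξ_meas : ∀ k, Measurable (ξ k)) {B : ℕ → Set α}
    (hB : ∀ k, MeasurableSet (B k)) (n : ℕ) (u : ℂ) :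
    ∫ ω, u ^ Nat.count (fun k => ξ k ω ∈ B k) n ∂P =
      ∏ k ∈ Finset.range n, (1 + (u - 1) * P.real (ξ k ⁻¹' B k)) := by
  have := hξ.isProbabilityMeasure
  have hpow (ω : Ω) : u ^ Nat.count (fun k => ξ k ω ∈ B k) n =
      ∏ k ∈ Finset.range n, if ξ k ω ∈ B k then u else 1 := by
    rw [Nat.count_eq_card_filter_range, Finset.prod_ite, Finset.prod_const, Finset.prod_const_one,
      mul_one]
  calc ∫ ω, u ^ Nat.count (fun k => ξ k ω ∈ B k) n ∂P
      = ∏ k ∈ Finset.range n, ∫ ω, (if ξ k ω ∈ B k then u else 1) ∂P := by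
        simp_rw [hpow]
        exact integral_prod_range_of_iIndepFun (f := fun k x => if x ∈ B k then u else 1) hξ hξ_meas
          (fun k => Measurable.ite (hB k) measurable_const measurable_const) n
    _ = ∏ k ∈ Finset.range n, (1 + (u - 1) * P.real (ξ k ⁻¹' B k)) :=
        Finset.prod_congr rfl fun k _ => integral_ite_mem (hξ_meas k (hB k)) u

theorem norm_one_add_sub_one_mul_le {u : ℂ} (hu : ‖u‖ ≤ 1) {p : ℝ} (hp : p ∈ Icc 0 1) :
    ‖1 + (u - 1) * (p : ℂ)‖ ≤ 1 := by
  have hconvex : 1 + (u - 1) * (p : ℂ) = (1 - p : ℝ) • (1 : ℂ) + p • u := by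
    simp only [Complex.real_smul]
    push_cast
    ring
  rw [hconvex, ← mem_closedBall_zero_iff]
  exact convex_closedBall 0 1 (by simp) (by simpa using hu) (sub_nonneg.2 hp.2) hp.1 (by ring)

theorem hasLaw_poissonMeasure_of_integral_pow [IsFiniteMeasure P] {M : Ω → ℕ} (hM : Measurable M)
    {r : ℝ≥0} (h : ∀ u : ℂ, ‖u‖ = 1 → ∫ ω, u ^ M ω ∂P = Complex.exp (r * (u - 1))) :
    HasLaw M (poissonMeasure r) P := by
  refine ⟨hM.aemeasurable, (MeasurableEmbedding.natCast (α := ℝ)).map_injective ?_⟩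
  refine Measure.ext_of_charFun (funext fun θ => ?_)
  rw [charFun_map_cast_poissonMeasure, ← h _ (Complex.norm_exp_ofReal_mul_I θ), charFun_apply_real,
    integral_map .of_discrete (by fun_prop), integral_map hM.aemeasurable .of_discrete]
  refine integral_congr_ae (.of_forall fun ω => ?_)
  dsimp only
  rw [← Complex.exp_nat_mul]
  push_cast
  ring_nf

namespace IsPoissonProcess

variable {N : ℝ≥0 → Ω → ℕ} {ν : Measure ℝ≥0} {α : Type*} [MeasurableSpace α] {ρ : Measure α}
  {ξ : ℕ → Ω → α} {S : Set (ℝ≥0 × α)}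

theorem indepFun_epoch {β : Type*} [MeasurableSpace β] {W : Ω → β} (hN : IsPoissonProcess N ν P)
    (hNW : IndepFun (fun ω s => N s ω) W P) (t : ℝ≥0) :
    IndepFun (fun ω => (N t ω, epoch fun s => N s ω)) W P := by
  have heval (s : ℝ≥0) : Measurable fun y : {y // IsCountingPath y} => y.1 s :=
    (measurable_pi_apply s).comp measurable_subtype_coe
  have hcount : Measurable fun y : {y // IsCountingPath y} => (y.1 t, epoch y.1) :=
    (heval t).prodMk (measurable_pi_lambda _ (measurable_epoch heval fun y => y.2))
  exact (indepFun_subtype_mk hNW hN.isCountingPath).comp hcount measurable_id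

open Classical in
theorem integral_pow_count_mem (hN : IsPoissonProcess N ν P)
    (hξ_meas : ∀ k, Measurable (ξ k)) (hξ_law : ∀ k, HasLaw (ξ k) ρ P) (hξ_indep : iIndepFun ξ P)
    (hNξ : IndepFun (fun ω s => N s ω) (fun ω k => ξ k ω) P) (hS : MeasurableSet S) (t : ℝ≥0)
    {u : ℂ} (hu : ‖u‖ ≤ 1) :
    ∫ ω, u ^ Nat.count (fun k => (epoch (fun s => N s ω) k, ξ k ω) ∈ S) (N t ω) ∂P =
      ∫ ω, ∏ k ∈ Finset.range (N t ω),
        (1 + (u - 1) * ρ.real (Prod.mk (epoch (fun s => N s ω) k) ⁻¹' S)) ∂P := by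
  have := hN.isProbabilityMeasure
  let G (q : (ℕ × (ℕ → ℝ≥0)) × (ℕ → α)) : ℂ :=
    u ^ Nat.count (fun k => (q.1.2 k, q.2 k) ∈ S) q.1.1
  have hG : StronglyMeasurable G :=
    ((measurable_from_nat (f := fun n => u ^ n)).comp (measurable_count
      (A := fun k => {q : (ℕ × (ℕ → ℝ≥0)) × (ℕ → α) | (q.1.2 k, q.2 k) ∈ S})
      (fun k => hS.preimage (by fun_prop)) (by fun_prop))).stronglyMeasurable
  have hG_le (q) : ‖G q‖ ≤ 1 := by
    rw [norm_pow]
    exact pow_le_one₀ (norm_nonneg u) hu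
  have hepoch : Measurable fun ω => (N t ω, epoch fun s => N s ω) :=
    (hN.measurable t).prodMk
      (measurable_pi_lambda _ (measurable_epoch hN.measurable hN.isCountingPath))
  calc ∫ ω, G ((N t ω, epoch fun s => N s ω), fun k => ξ k ω) ∂P
      = ∫ ω, ∫ ω', G ((N t ω, epoch fun s => N s ω), fun k => ξ k ω') ∂P ∂P :=
        integral_comp_prodMk_of_indepFun hepoch (measurable_pi_lambda _ hξ_meas)
          (hN.indepFun_epoch hNξ t) hG
          (.of_bound hG.aestronglyMeasurable 1 (.of_forall hG_le))
    _ = ∫ ω, ∏ k ∈ Finset.range (N t ω),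
        (1 + (u - 1) * ρ.real (Prod.mk (epoch (fun s => N s ω) k) ⁻¹' S)) ∂P := by
        refine integral_congr_ae (.of_forall fun ω => ?_)
        refine (integral_pow_count hξ_indep hξ_meas
          (B := fun k => Prod.mk (epoch (fun s => N s ω) k) ⁻¹' S)
          (fun k => measurable_prodMk_left hS) _ u).trans (Finset.prod_congr rfl fun k _ => ?_)
        rw [← (hξ_law k).map_eq, map_measureReal_apply (hξ_meas k) (measurable_prodMk_left hS)]

open Classical in
theorem hasLaw_count_mem [IsLocallyFiniteMeasure ν] (hN : IsPoissonProcess N ν P)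
    (hξ_meas : ∀ k, Measurable (ξ k)) (hξ_law : ∀ k, HasLaw (ξ k) ρ P) (hξ_indep : iIndepFun ξ P)
    (hNξ : IndepFun (fun ω s => N s ω) (fun ω k => ξ k ω) P) (hS : MeasurableSet S)
    (hS_rc : IsRightCont fun s => ρ.real (Prod.mk s ⁻¹' S)) (t : ℝ≥0) :
    HasLaw (fun ω => Nat.count (fun k => (epoch (fun s => N s ω) k, ξ k ω) ∈ S) (N t ω))
      (poissonMeasure (∫ s in Ioc 0 t, ρ.real (Prod.mk s ⁻¹' S) ∂ν).toNNReal) P := by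
  have := hN.isProbabilityMeasure
  have := (hξ_law 0).isProbabilityMeasure_iff.1 ‹_›
  have hpoint (k : ℕ) : Measurable fun ω => (epoch (fun s => N s ω) k, ξ k ω) :=
    (measurable_epoch hN.measurable hN.isCountingPath k).prodMk (hξ_meas k)
  refine hasLaw_poissonMeasure_of_integral_pow
    (M := fun ω => Nat.count (fun k => (epoch (fun s => N s ω) k, ξ k ω) ∈ S) (N t ω))
    (measurable_count (fun k => hpoint k hS) (hN.measurable t)) fun u hu => ?_
  rw [hN.integral_pow_count_mem hξ_meas hξ_law hξ_indep hNξ hS t hu.le,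
    hN.integral_prod_epoch (h := fun s => 1 + (u - 1) * ρ.real (Prod.mk s ⁻¹' S))
      (fun s => continuousWithinAt_const.add (continuousWithinAt_const.mul
        (Complex.continuous_ofReal.continuousAt.comp_continuousWithinAt (hS_rc s))))
      (fun s => norm_one_add_sub_one_mul_le hu.le ⟨measureReal_nonneg, measureReal_le_one⟩)]
  have hcoe : (((∫ s in Ioc 0 t, ρ.real (Prod.mk s ⁻¹' S) ∂ν).toNNReal : ℝ≥0) : ℂ) =
      ∫ s in Ioc 0 t, (ρ.real (Prod.mk s ⁻¹' S) : ℂ) ∂ν := by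
    rw [integral_complex_ofReal]
    exact congrArg _ (Real.coe_toNNReal _ (integral_nonneg fun _ => measureReal_nonneg))
  simp only [add_sub_cancel_left, integral_const_mul, hcoe, mul_comm]

end IsPoissonProcess

end Count

/-! ### Conditioning on an independent variable -/

section Conditioning

variable {Ω α β γ : Type*} [MeasurableSpace Ω] [MeasurableSpace α] [MeasurableSpace β]
  [MeasurableSpace γ] {P : Measure Ω} [IsFiniteMeasure P] {X : Ω → α} {W : Ω → β}
  {F : α → β → γ} {κ : Kernel α γ}

theorem map_prodMk_eq_compProd_of_indepFun [IsSFiniteKernel κ] (hX : Measurable X)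
    (hW : Measurable W) (hXW : IndepFun X W P) (hF : Measurable F.uncurry)
    (hκ : ∀ x, HasLaw (fun ω => F x (W ω)) (κ x) P) :
    P.map (fun ω => (X ω, F (X ω) (W ω))) = P.map X ⊗ₘ κ := by
  have hXF : Measurable fun q : α × β => (q.1, F q.1 q.2) := measurable_fst.prodMk hF
  ext s hs
  calc P.map (fun ω => (X ω, F (X ω) (W ω))) s
      = ((P.map X).prod (P.map W)) ((fun q : α × β => (q.1, F q.1 q.2)) ⁻¹' s) := by
        rw [← hXW.map_prod_eq_prod_map_map hX.aemeasurable hW.aemeasurable,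
          ← Measure.map_apply hXF hs, Measure.map_map hXF (hX.prodMk hW)]
        rfl
    _ = ∫⁻ x, κ x (Prod.mk x ⁻¹' s) ∂(P.map X) := by
        rw [Measure.prod_apply (hXF hs)]
        refine lintegral_congr fun x => ?_
        have hsection : MeasurableSet (Prod.mk x ⁻¹' s) := measurable_prodMk_left hs
        have hFx : Measurable (F x) := hF.of_uncurry_left
        rw [← (hκ x).map_eq]
        exact (Measure.map_apply hW (hFx hsection)).trans
          (Measure.map_apply (hFx.comp hW) hsection).symm
    _ = (P.map X ⊗ₘ κ) s := (Measure.compProd_apply hs).symm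

theorem condExp_preimage_ae_eq_of_indepFun [StandardBorelSpace γ] [Nonempty γ] [IsFiniteKernel κ]
    (hX : Measurable X) (hW : Measurable W) (hXW : IndepFun X W P) (hF : Measurable F.uncurry)
    (hκ : ∀ x, HasLaw (fun ω => F x (W ω)) (κ x) P) {A : Set γ} (hA : MeasurableSet A) :
    P⟦(fun ω => F (X ω) (W ω)) ⁻¹' A | MeasurableSpace.comap X inferInstance⟧
      =ᵐ[P] fun ω => (κ (X ω)).real A := by
  have hFX : Measurable fun ω => F (X ω) (W ω) := hF.comp (hX.prodMk hW)
  have hcondDistrib := condDistrib_ae_eq_of_measure_eq_compProd_of_measurable hX hFX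
    (map_prodMk_eq_compProd_of_indepFun hX hW hXW hF hκ)
  refine (condDistrib_ae_eq_condExp hX hFX hA).symm.trans ?_
  filter_upwards [ae_of_ae_map hX.aemeasurable hcondDistrib] with ω hω
  rw [hω]

theorem hasLaw_bind_of_indepFun [IsSFiniteKernel κ]
    (hX : Measurable X) (hW : Measurable W) (hXW : IndepFun X W P) (hF : Measurable F.uncurry)
    (hκ : ∀ x, HasLaw (fun ω => F x (W ω)) (κ x) P) :
    HasLaw (fun ω => F (X ω) (W ω)) (P.bind fun ω => κ (X ω)) P where
  aemeasurable := (hF.comp (hX.prodMk hW)).aemeasurable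
  map_eq :=
    calc P.map (fun ω => F (X ω) (W ω))
        = (P.map fun ω => (X ω, F (X ω) (W ω))).snd :=
          (Measure.snd_map_prodMk hX).symm
      _ = (P.map X).bind κ := by
          rw [map_prodMk_eq_compProd_of_indepFun hX hW hXW hF hκ, Measure.snd_compProd]
      _ = P.bind fun ω => κ (X ω) := by
          rw [Measure.bind, Measure.map_map κ.measurable hX]
          rfl

end Conditioning

theorem measurable_poissonMeasure : Measurable poissonMeasure := by
  refine Measure.measurable_of_measurable_coe _ fun A hA => ?_
  simp_rw [poissonMeasure, Measure.sum_apply _ hA, Measure.smul_apply, smul_eq_mul]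
  exact Measurable.tsum fun n => Measurable.mul_const (by fun_prop) _

/-- The Poisson law as a Markov kernel from its parameter to `ℕ`. -/
def poissonKernel : Kernel ℝ≥0 ℕ := ⟨poissonMeasure, measurable_poissonMeasure⟩

instance : IsMarkovKernel poissonKernel :=
  ⟨fun r => inferInstanceAs (IsProbabilityMeasure (poissonMeasure r))⟩

/-! ### Rates along a path -/

/-- Lebesgue measure on `[0, ∞)`. -/
def lebesgue : Measure ℝ≥0 := (volume : Measure ℝ).comap (↑)

theorem measurableEmbedding_coe_nnreal : MeasurableEmbedding ((↑) : ℝ≥0 → ℝ) :=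
  .subtype_coe measurableSet_Ici

instance : IsLocallyFiniteMeasure lebesgue :=
  have := IsFiniteMeasureOnCompacts.comap' volume NNReal.continuous_coe
    measurableEmbedding_coe_nnreal
  inferInstanceAs (IsLocallyFiniteMeasure ((volume : Measure ℝ).comap ((↑) : ℝ≥0 → ℝ)))

theorem setIntegral_Ioc_toNNReal {F : Type*} [NormedAddCommGroup F] [NormedSpace ℝ F]
    (g : ℝ≥0 → F) (s t : ℝ≥0) :
    ∫ r in Ioc (s : ℝ) t, g r.toNNReal = ∫ r in Ioc s t, g r ∂lebesgue := by
  have hrange : Ioc (s : ℝ) t ⊆ range ((↑) : ℝ≥0 → ℝ) := fun r hr =>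
    ⟨⟨r, s.2.trans hr.1.le⟩, rfl⟩
  have hpreimage : ((↑) : ℝ≥0 → ℝ) ⁻¹' Ioc s t = Ioc s t := by ext; simp
  calc ∫ r in Ioc (s : ℝ) t, g r.toNNReal
      = ∫ r in Ioc (s : ℝ) t, g r.toNNReal ∂(lebesgue.map (↑)) := by
        rw [lebesgue, measurableEmbedding_coe_nnreal.map_comap,
          Measure.restrict_restrict_of_subset hrange]
    _ = ∫ r in Ioc s t, g r ∂lebesgue := by
        simp only [measurableEmbedding_coe_nnreal.setIntegral_map, hpreimage, Real.toNNReal_coe]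

/-- The measure on `[0, ∞)` with Lebesgue density `a`. -/
def rateMeasure (a : ℝ≥0 → ℝ≥0) : Measure ℝ≥0 := lebesgue.withDensity fun s => a s

/-- The paths that qualify as time-varying rates: right-continuous and locally integrable. -/
structure IsRatePath (a : ℝ≥0 → ℝ≥0) : Prop where
  isRightCont : IsRightCont a
  locallyIntegrable : LocallyIntegrable (fun s => (a s : ℝ)) lebesgue

theorem IsRatePath.isLocallyFiniteMeasure {a : ℝ≥0 → ℝ≥0} (ha : IsRatePath a) :
    IsLocallyFiniteMeasure (rateMeasure a) where
  finiteAtNhds t := by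
    obtain ⟨s, hs, hint⟩ := ha.locallyIntegrable t
    refine ⟨s, hs, ?_⟩
    rw [rateMeasure, withDensity_apply']
    simpa [HasFiniteIntegral] using hint.hasFiniteIntegral

theorem toReal_rateMeasure_Ioc {a : ℝ≥0 → ℝ≥0} (ha : Measurable a) (s t : ℝ≥0) :
    (rateMeasure a (Ioc s t)).toReal = ∫ r in Ioc (s : ℝ) t, (a r.toNNReal : ℝ) := by
  rw [setIntegral_Ioc_toNNReal (fun r => (a r : ℝ)), rateMeasure,
    withDensity_apply _ measurableSet_Ioc, integral_eq_lintegral_of_nonneg_ae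
      (.of_forall fun _ => NNReal.coe_nonneg _) ha.coe_nnreal_real.aestronglyMeasurable]
  simp only [ENNReal.ofReal_coe_nnreal]

theorem measurable_cumulative_rateMeasure {Ω : Type*} [MeasurableSpace Ω] {a : ℝ≥0 → Ω → ℝ≥0}
    (ha : Measurable fun q : ℝ≥0 × Ω => a q.1 q.2) (t : ℝ≥0) :
    Measurable fun ω => cumulative (rateMeasure fun s => a s ω) t := by
  simp only [cumulative, rateMeasure, withDensity_apply _ measurableSet_Ioc]
  exact ha.coe_nnreal_ennreal.lintegral_prod_left'.ennreal_toNNReal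

/-! ### The queue along a fixed background path -/

section FixedPath

variable {E : Type*} {lam kap mu : E → ℝ≥0} {f : ℝ≥0 → E}

theorem cumulativeRate_eq_cumulative (hlam : Measurable fun s => lam (f s)) :
    cumulativeRate lam f = cumulative (rateMeasure fun s => lam (f s)) := by
  ext t
  change (∫ s in (0 : ℝ)..t, (lam (f s.toNNReal) : ℝ)) = (rateMeasure _ (Ioc 0 t)).toReal
  rw [toReal_rateMeasure_Ioc hlam, intervalIntegral.integral_of_le t.coe_nonneg, NNReal.coe_zero]

theorem isCountingPath_arrivals (hlam : IsRatePath fun s => lam (f s)) {Y : ℝ≥0 → ℕ}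
    (hY : IsCountingPath Y) : IsCountingPath (arrivals lam f Y) := by
  have := hlam.isLocallyFiniteMeasure
  change IsCountingPath fun t => Y (cumulativeRate lam f t)
  rw [cumulativeRate_eq_cumulative hlam.isRightCont.measurable]
  exact hY.comp (by simp [cumulative]) (monotone_cumulative _) (isRightCont_cumulative _)

theorem workDone_eq_cumulative_sub (hmu : IsRatePath fun s => mu (f s)) (s t : ℝ≥0) :
    workDone mu f s t = ((cumulative (rateMeasure fun s => mu (f s)) t -
      cumulative (rateMeasure fun s => mu (f s)) s : ℝ≥0) : ℝ) := by
  have := hmu.isLocallyFiniteMeasure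
  rw [cumulative_sub, workDone, integral_Ico_eq_integral_Ioc, ENNReal.coe_toNNReal_eq_toReal,
    toReal_rateMeasure_Ioc hmu.isRightCont.measurable]

theorem workDone_nonneg (mu : E → ℝ≥0) (f : ℝ≥0 → E) (s t : ℝ≥0) : 0 ≤ workDone mu f s t :=
  integral_nonneg fun _ => NNReal.coe_nonneg _

theorem isRightCont_workDone (hmu : IsRatePath fun s => mu (f s)) (t : ℝ≥0) :
    IsRightCont fun s => workDone mu f s t := by
  have := hmu.isLocallyFiniteMeasure
  simp only [workDone_eq_cumulative_sub hmu]
  exact fun s => NNReal.continuous_coe.continuousAt.comp_continuousWithinAt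
    (continuousWithinAt_const.sub (isRightCont_cumulative _ s))

/-- The probability that a job arriving at time `s ≤ t` is still in the system at time `t`. -/
def survival (kap mu : E → ℝ≥0) (f : ℝ≥0 → E) (t s : ℝ≥0) : ℝ :=
  Real.exp (-(kap (f s) : ℝ) * workDone mu f s t)

theorem isRightCont_survival (hkap : IsRightCont fun s => kap (f s))
    (hmu : IsRatePath fun s => mu (f s)) (t : ℝ≥0) : IsRightCont (survival kap mu f t) := fun s =>
  Real.continuous_exp.continuousAt.comp_continuousWithinAt
    ((NNReal.continuous_coe.continuousAt.comp_continuousWithinAt (hkap s)).neg.mul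
      (isRightCont_workDone hmu t s))

theorem poissonParameter_eq_integral_survival (hlam : Measurable fun s => lam (f s)) (t : ℝ≥0) :
    poissonParameter lam kap mu t f =
      (∫ s in Ioc 0 t, survival kap mu f t s ∂rateMeasure fun s => lam (f s)).toNNReal := by
  have hintegrand : ∀ r ∈ Ioc (0 : ℝ) t, (lam (f r.toNNReal) : ℝ) *
      Real.exp (-(kap (f r.toNNReal) : ℝ) * ∫ q in r..t, (mu (f q.toNNReal) : ℝ)) =
        lam (f r.toNNReal) • survival kap mu f t r.toNNReal := fun r hr => by
    rw [survival, workDone, integral_Ico_eq_integral_Ioc, Real.coe_toNNReal r hr.1.le,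
      ← intervalIntegral.integral_of_le hr.2, NNReal.smul_def, smul_eq_mul]
  refine Real.toNNReal_coe.symm.trans (congrArg Real.toNNReal ?_)
  calc (poissonParameter lam kap mu t f : ℝ)
      = ∫ r in Ioc (0 : ℝ) t, (lam (f r.toNNReal) : ℝ) *
          Real.exp (-(kap (f r.toNNReal) : ℝ) * ∫ q in r..t, (mu (f q.toNNReal) : ℝ)) :=
        intervalIntegral.integral_of_le t.coe_nonneg
    _ = ∫ r in Ioc (0 : ℝ) t, lam (f r.toNNReal) • survival kap mu f t r.toNNReal :=
        setIntegral_congr_fun measurableSet_Ioc hintegrand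
    _ = ∫ s in Ioc 0 t, lam (f s) • survival kap mu f t s ∂lebesgue :=
        setIntegral_Ioc_toNNReal (fun s => lam (f s) • survival kap mu f t s) 0 t
    _ = ∫ s in Ioc 0 t, survival kap mu f t s ∂rateMeasure fun s => lam (f s) :=
        (setIntegral_withDensity_eq_setIntegral_smul hlam _ measurableSet_Ioc).symm

/-- The arrival times `s` and exponential draws `z` of the jobs that are still in the system at
time `t`, provided that they have arrived by then. -/
def unservedJobs (kap mu : E → ℝ≥0) (f : ℝ≥0 → E) (t : ℝ≥0) : Set (ℝ≥0 × ℝ) :=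
  {q | ((workDone mu f q.1 t : ℝ) : EReal) < serviceRequirement kap (f q.1) q.2}

theorem mem_unservedJobs_iff {t s : ℝ≥0} {z : ℝ} :
    (s, z) ∈ unservedJobs kap mu f t ↔ kap (f s) = 0 ∨ workDone mu f s t * kap (f s) < z := by
  rcases eq_zero_or_pos (kap (f s)) with hkap | hkap
  · simp [unservedJobs, serviceRequirement, hkap]
  · simp [unservedJobs, serviceRequirement, hkap, hkap.ne', lt_div_iff₀]

theorem measureReal_unservedJobs (kap mu : E → ℝ≥0) (f : ℝ≥0 → E) (t s : ℝ≥0) :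
    (expMeasure 1).real (Prod.mk s ⁻¹' unservedJobs kap mu f t) = survival kap mu f t s := by
  have := isProbabilityMeasure_expMeasure one_pos
  rcases eq_or_ne (kap (f s)) 0 with hkap | hkap
  · have hsection : Prod.mk s ⁻¹' unservedJobs kap mu f t = univ :=
      eq_univ_of_forall fun z => mem_unservedJobs_iff.2 (.inl hkap)
    simp [hsection, survival, hkap]
  · have hsection : Prod.mk s ⁻¹' unservedJobs kap mu f t =
        (Iic (workDone mu f s t * kap (f s)))ᶜ := by
      ext z
      simp [mem_unservedJobs_iff, hkap]
    rw [hsection, probReal_compl_eq_one_sub measurableSet_Iic, ← cdf_eq_real,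
      cdf_expMeasure_eq one_pos,
      if_pos (mul_nonneg (workDone_nonneg mu f s t) (NNReal.coe_nonneg _)), survival]
    ring_nf

open Classical in
theorem numJobs_eq_count {Y : ℝ≥0 → ℕ} (hY : IsCountingPath (arrivals lam f Y)) (Z : ℕ → ℝ)
    (t : ℝ≥0) :
    numJobs lam kap mu f Y Z t =
      Nat.count (fun k => (epoch (arrivals lam f Y) k, Z (k + 1)) ∈ unservedJobs kap mu f t)
        (arrivals lam f Y t) := by
  have hentered (k : ℕ) : HasEntered lam f Y t (k + 1) ↔ k < arrivals lam f Y t :=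
    hY.jumpTime_le_iff
  have hleft (k : ℕ) : HasLeft lam kap mu f Y Z t (k + 1) ↔ HasEntered lam f Y t (k + 1) ∧
      (epoch (arrivals lam f Y) k, Z (k + 1)) ∉ unservedJobs kap mu f t :=
    and_congr_right fun _ => not_lt.symm
  rw [numJobs, tsum_eq_sum (s := Finset.range (arrivals lam f Y t)), Nat.count_eq_card_filter_range,
    Finset.card_filter]
  · refine Finset.sum_congr rfl fun k hk => ?_
    simp only [hleft, hentered, Finset.mem_range.1 hk, true_and, if_true]
    split_ifs <;> simp_all
  · intro k hk
    simp only [hleft, hentered, Finset.mem_range.not.1 hk, false_and, if_false, tsub_self]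

theorem finite_hasEntered {Y : ℝ≥0 → ℕ} (hY : IsCountingPath (arrivals lam f Y)) (t : ℝ≥0) :
    {k : ℕ | HasEntered lam f Y t k}.Finite :=
  (finite_Iic (arrivals lam f Y t)).subset fun _ hk => hY.jumpTime_le_iff.1 hk

end FixedPath

/-! ### Measurability of the queue in the randomness -/

/-- The background paths `f` along which the arrival and service mechanisms are well behaved: the
modulated rates `λ(f)` and `μ(f)` are right-continuous and locally integrable, and `κ(f)` is
right-continuous. -/
structure IsAdmissiblePath {E : Type*} (lam kap mu : E → ℝ≥0) (f : ℝ≥0 → E) : Prop where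
  lam : IsRatePath fun s => lam (f s)
  kap : IsRightCont fun s => kap (f s)
  mu : IsRatePath fun s => mu (f s)

section Randomness

variable {Ω : Type*} [MeasurableSpace Ω] {E : Type*} {lam kap mu : E → ℝ≥0}
  {J : ℝ≥0 → Ω → E} {Y : ℝ≥0 → Ω → ℕ} {Z : ℕ → Ω → ℝ}

theorem measurable_arrivals (hlam : ∀ s, Measurable fun ω => lam (J s ω))
    (hlam_rate : ∀ ω, IsRatePath fun s => lam (J s ω)) (hY : ∀ s, Measurable (Y s))
    (hY_path : ∀ ω, IsCountingPath fun s => Y s ω) (t : ℝ≥0) :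
    Measurable fun ω => arrivals lam (fun s => J s ω) (fun s => Y s ω) t := by
  simp only [arrivals, cumulativeRate_eq_cumulative (hlam_rate _).isRightCont.measurable]
  exact (measurable_uncurry_of_isRightCont hY fun ω => (hY_path ω).rightCont).comp
    ((measurable_cumulative_rateMeasure (measurable_uncurry_of_isRightCont hlam
      fun ω => (hlam_rate ω).isRightCont) t).prodMk measurable_id)

theorem measurable_uncurry_workDone (hmu : ∀ s, Measurable fun ω => mu (J s ω))
    (hmu_rate : ∀ ω, IsRatePath fun s => mu (J s ω)) (t : ℝ≥0) :
    Measurable fun q : ℝ≥0 × Ω => workDone mu (fun s => J s q.2) q.1 t := by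
  refine measurable_uncurry_of_isRightCont (X := fun s ω => workDone mu (fun r => J r ω) s t)
    (fun s => ?_) fun ω => isRightCont_workDone (hmu_rate ω) t
  have hcumulative := measurable_cumulative_rateMeasure (measurable_uncurry_of_isRightCont hmu
    fun ω => (hmu_rate ω).isRightCont)
  simp only [workDone_eq_cumulative_sub (hmu_rate _)]
  exact ((hcumulative t).sub (hcumulative s)).coe_nnreal_real

theorem measurable_poissonParameter (hlam : ∀ s, Measurable fun ω => lam (J s ω))
    (hkap : ∀ s, Measurable fun ω => kap (J s ω)) (hmu : ∀ s, Measurable fun ω => mu (J s ω))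
    (hJ : ∀ ω, IsAdmissiblePath lam kap mu fun s => J s ω) (t : ℝ≥0) :
    Measurable fun ω => poissonParameter lam kap mu t fun s => J s ω := by
  have hlam_joint := measurable_uncurry_of_isRightCont hlam fun ω => (hJ ω).lam.isRightCont
  have hkap_joint := measurable_uncurry_of_isRightCont hkap fun ω => (hJ ω).kap
  have hsurvival : Measurable fun q : ℝ≥0 × Ω => survival kap mu (fun s => J s q.2) t q.1 :=
    (hkap_joint.coe_nnreal_real.neg.mul
      (measurable_uncurry_workDone hmu (fun ω => (hJ ω).mu) t)).exp
  simp only [poissonParameter_eq_integral_survival (hJ _).lam.isRightCont.measurable,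
    rateMeasure, setIntegral_withDensity_eq_setIntegral_smul
      (hJ _).lam.isRightCont.measurable _ measurableSet_Ioc]
  exact (hlam_joint.smul hsurvival).stronglyMeasurable.integral_prod_left'.measurable.real_toNNReal

theorem measurableSet_unservedJobs (hkap : ∀ s, Measurable fun ω => kap (J s ω))
    (hkap_path : ∀ ω, IsRightCont fun s => kap (J s ω))
    (hmu : ∀ s, Measurable fun ω => mu (J s ω)) (hmu_rate : ∀ ω, IsRatePath fun s => mu (J s ω))
    (t : ℝ≥0) {T : Ω → ℝ≥0} (hT : Measurable T) {z : Ω → ℝ} (hz : Measurable z) :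
    MeasurableSet {ω | (T ω, z ω) ∈ unservedJobs kap mu (fun s => J s ω) t} := by
  have hkap_T : Measurable fun ω => kap (J (T ω) ω) :=
    (measurable_uncurry_of_isRightCont hkap hkap_path).comp (hT.prodMk measurable_id)
  have hwork_T : Measurable fun ω => workDone mu (fun s => J s ω) (T ω) t :=
    (measurable_uncurry_workDone hmu hmu_rate t).comp (hT.prodMk measurable_id)
  simp only [mem_unservedJobs_iff]
  exact (hkap_T (measurableSet_singleton 0)).union
    (measurableSet_lt (hwork_T.mul hkap_T.coe_nnreal_real) hz)

theorem measurable_numJobs (hlam : ∀ s, Measurable fun ω => lam (J s ω))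
    (hkap : ∀ s, Measurable fun ω => kap (J s ω)) (hmu : ∀ s, Measurable fun ω => mu (J s ω))
    (hJ : ∀ ω, IsAdmissiblePath lam kap mu fun s => J s ω) (hY : ∀ s, Measurable (Y s))
    (hY_path : ∀ ω, IsCountingPath fun s => Y s ω) (hZ : ∀ k, Measurable (Z k)) (t : ℝ≥0) :
    Measurable fun ω =>
      numJobs lam kap mu (fun s => J s ω) (fun s => Y s ω) (fun k => Z k ω) t := by
  have harrivals := measurable_arrivals hlam (fun ω => (hJ ω).lam) hY hY_path
  have harrivals_path (ω : Ω) := isCountingPath_arrivals (hJ ω).lam (hY_path ω)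
  simp only [numJobs_eq_count (harrivals_path _)]
  exact measurable_count (fun k => measurableSet_unservedJobs hkap (fun ω => (hJ ω).kap) hmu
    (fun ω => (hJ ω).mu) t (measurable_epoch harrivals harrivals_path k) (hZ (k + 1)))
    (harrivals t)

end Randomness

/-! ### The law of the number of jobs -/

section Law

variable {Ω : Type*} [MeasurableSpace Ω] {P : Measure Ω} {E : Type*} {lam kap mu : E → ℝ≥0}
  {Y : ℝ≥0 → Ω → ℕ} {Z : ℕ → Ω → ℝ}

theorem IsStandardPoissonProcess.isPoissonProcess_arrivals (hY : IsStandardPoissonProcess Y P)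
    {f : ℝ≥0 → E} (hlam : IsRatePath fun s => lam (f s)) :
    IsPoissonProcess (fun t ω => arrivals lam f (fun s => Y s ω) t)
      (rateMeasure fun s => lam (f s)) P := by
  have := hlam.isLocallyFiniteMeasure
  simp only [arrivals, cumulativeRate_eq_cumulative hlam.isRightCont.measurable]
  exact hY.isPoissonProcess_comp_cumulative _

theorem hasLaw_numJobs {f : ℝ≥0 → E} (hf : IsAdmissiblePath lam kap mu f)
    (hY : IsStandardPoissonProcess Y P) (hZ_meas : ∀ k, Measurable (Z k))
    (hZ_law : ∀ k, HasLaw (Z k) (expMeasure 1) P) (hZ_indep : iIndepFun Z P)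
    (hYZ : IndepFun (fun ω s => Y s ω) (fun ω k => Z k ω) P) (t : ℝ≥0) :
    HasLaw (fun ω => numJobs lam kap mu f (fun s => Y s ω) (fun k => Z k ω) t)
      (poissonMeasure (poissonParameter lam kap mu t f)) P := by
  have := hf.lam.isLocallyFiniteMeasure
  have harrivals := hY.isPoissonProcess_arrivals hf.lam
  have hindep : IndepFun (fun ω s => arrivals lam f (fun r => Y r ω) s)
      (fun ω k => Z (k + 1) ω) P := by
    have htime_change : Measurable fun (y : ℝ≥0 → ℕ) s => arrivals lam f y s :=
      measurable_pi_lambda _ fun _ => measurable_pi_apply _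
    have hshift : Measurable fun (z : ℕ → ℝ) k => z (k + 1) :=
      measurable_pi_lambda _ fun _ => measurable_pi_apply _
    exact hYZ.comp htime_change hshift
  have hunserved : MeasurableSet (unservedJobs kap mu f t) :=
    measurableSet_unservedJobs (J := fun s _ => f s) (fun _ => measurable_const)
      (fun _ => hf.kap) (fun _ => measurable_const) (fun _ => hf.mu) t measurable_fst
      measurable_snd
  have hsurvival := measureReal_unservedJobs kap mu f t
  have hlaw := harrivals.hasLaw_count_mem (fun k => hZ_meas (k + 1)) (fun k => hZ_law (k + 1))
    (hZ_indep.precomp (add_left_injective 1)) hindep hunserved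
    (by simpa only [hsurvival] using isRightCont_survival hf.kap hf.mu t) t
  simp only [numJobs_eq_count (isCountingPath_arrivals hf.lam (hY.isCountingPath _)),
    poissonParameter_eq_integral_survival hf.lam.isRightCont.measurable, ← hsurvival]
  exact hlaw

end Law

/-! ### Freezing the background path -/

section Freezing

variable {E : Type*} (lam kap mu : E → ℝ≥0)

/-- The space of admissible background paths, in which the environment of the queue takes its
values. It carries the σ-algebra generated by the coordinates. -/
abbrev AdmissiblePath := {f : ℝ≥0 → E // IsAdmissiblePath lam kap mu f}

/-- The space of values of the randomness other than the background process: a counting path, which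
drives the arrivals, and a sequence of draws, which drives the service requirements. -/
abbrev DrivingData := {q : (ℝ≥0 → ℕ) × (ℕ → ℝ) // IsCountingPath q.1}

variable [MeasurableSpace E] {lam kap mu}

theorem measurable_poissonParameter_path (hlam : Measurable lam) (hkap : Measurable kap)
    (hmu : Measurable mu) (t : ℝ≥0) :
    Measurable fun f : AdmissiblePath lam kap mu => poissonParameter lam kap mu t f.1 := by
  have heval (s : ℝ≥0) : Measurable fun f : AdmissiblePath lam kap mu => f.1 s :=
    (measurable_pi_apply s).comp measurable_subtype_coe
  exact measurable_poissonParameter (J := fun s (f : AdmissiblePath lam kap mu) => f.1 s)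
    (fun s => hlam.comp (heval s)) (fun s => hkap.comp (heval s)) (fun s => hmu.comp (heval s))
    (fun f => f.2) t

theorem measurable_uncurry_numJobs (hlam : Measurable lam) (hkap : Measurable kap)
    (hmu : Measurable mu) (t : ℝ≥0) :
    Measurable (Function.uncurry fun (f : AdmissiblePath lam kap mu) (q : DrivingData) =>
      numJobs lam kap mu f.1 q.1.1 q.1.2 t) := by
  have hpath (s : ℝ≥0) : Measurable fun p : AdmissiblePath lam kap mu × DrivingData => p.1.1 s :=
    (measurable_pi_apply s).comp (measurable_subtype_coe.comp measurable_fst)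
  have hdata : Measurable fun p : AdmissiblePath lam kap mu × DrivingData => p.2.1 :=
    measurable_subtype_coe.comp measurable_snd
  exact measurable_numJobs
    (J := fun s (p : AdmissiblePath lam kap mu × DrivingData) => p.1.1 s)
    (Y := fun s p => p.2.1.1 s) (Z := fun k p => p.2.1.2 k)
    (fun s => hlam.comp (hpath s)) (fun s => hkap.comp (hpath s)) (fun s => hmu.comp (hpath s))
    (fun p => p.1.2) (fun s => (measurable_pi_apply s).comp (measurable_fst.comp hdata))
    (fun p => p.2.2) (fun k => (measurable_pi_apply k).comp (measurable_snd.comp hdata)) t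

end Freezing

theorem IsCadlag.isAdmissiblePath {E : Type*} [TopologicalSpace E] {lam kap mu : E → ℝ≥0}
    {f : ℝ≥0 → E} (hf : IsCadlag f) (hlam : Continuous lam) (hkap : Continuous kap)
    (hmu : Continuous mu) : IsAdmissiblePath lam kap mu f where
  lam := ⟨(hf.comp hlam).isRightCont,
    (hf.comp (NNReal.continuous_coe.comp hlam)).locallyIntegrable lebesgue⟩
  kap := (hf.comp hkap).isRightCont
  mu := ⟨(hf.comp hmu).isRightCont,
    (hf.comp (NNReal.continuous_coe.comp hmu)).locallyIntegrable lebesgue⟩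

end ModulatedQueue

end

theorem mainTheorem2_general {Ω : Type*} [MeasurableSpace Ω] {P : Measure Ω}
    [IsProbabilityMeasure P] {E : Type*} [MeasurableSpace E] {lam kap mu : E → ℝ≥0}
    (hlam : Measurable lam) (hkap : Measurable kap) (hmu : Measurable mu)
    {J : ℝ≥0 → Ω → E} (hJ_meas : ∀ s, Measurable (J s))
    (hJ_path : ∀ ω, ModulatedQueue.IsAdmissiblePath lam kap mu fun s => J s ω)
    {Ybar : ℝ≥0 → Ω → ℕ} (hY : ModulatedQueue.IsStandardPoissonProcess Ybar P)
    {Zbar : ℕ → Ω → ℝ} (hZ_meas : ∀ k, Measurable (Zbar k))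
    (hZ_law : ∀ k, HasLaw (Zbar k) (expMeasure 1) P) (hZ_indep : iIndepFun Zbar P)
    (hYZ : IndepFun (fun ω s => Ybar s ω) (fun ω k => Zbar k ω) P)
    (hJYZ : IndepFun (fun ω s => J s ω) (fun ω => (fun s => Ybar s ω, fun k => Zbar k ω)) P)
    (t : ℝ≥0) :
    let M : Ω → ℕ := fun ω =>
      ModulatedQueue.numJobs lam kap mu (fun s => J s ω) (fun s => Ybar s ω)
        (fun k => Zbar k ω) t
    let phi : Ω → ℝ≥0 := fun ω =>
      ModulatedQueue.poissonParameter lam kap mu t (fun s => J s ω)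
    (∀ ω, {k : ℕ | ModulatedQueue.HasEntered lam (fun s => J s ω) (fun s => Ybar s ω) t
      k}.Finite) ∧
    Measurable M ∧ Measurable phi ∧
    (∀ A : Set ℕ, P⟦M ⁻¹' A | ⨆ s, MeasurableSpace.comap (J s) inferInstance⟧
        =ᵐ[P] fun ω => (poissonMeasure (phi ω)).real A) ∧
    HasLaw M (P.bind fun ω => poissonMeasure (phi ω)) P := by
  intro M phi
  let X (ω : Ω) : ModulatedQueue.AdmissiblePath lam kap mu := ⟨fun s => J s ω, hJ_path ω⟩
  let W (ω : Ω) : ModulatedQueue.DrivingData :=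
    ⟨(fun s => Ybar s ω, fun k => Zbar k ω), hY.isCountingPath ω⟩
  have hX : Measurable X := (measurable_pi_lambda _ hJ_meas).subtype_mk
  have hW : Measurable W := ((measurable_pi_lambda _ hY.measurable).prodMk
    (measurable_pi_lambda _ hZ_meas)).subtype_mk
  have hXW : IndepFun X W P := (ModulatedQueue.indepFun_subtype_mk
    (ModulatedQueue.indepFun_subtype_mk hJYZ hJ_path).symm hY.isCountingPath).symm
  have hM := ModulatedQueue.measurable_uncurry_numJobs hlam hkap hmu t
  have hphi := ModulatedQueue.measurable_poissonParameter_path hlam hkap hmu t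
  let κ := ModulatedQueue.poissonKernel.comap _ hphi
  have hκ (f : ModulatedQueue.AdmissiblePath lam kap mu) : HasLaw
      (fun ω => ModulatedQueue.numJobs lam kap mu f.1 (W ω).1.1 (W ω).1.2 t) (κ f) P :=
    ModulatedQueue.hasLaw_numJobs f.2 hY hZ_meas hZ_law hZ_indep hYZ t
  refine ⟨fun ω => ?_, (hM.comp (hX.prodMk hW) :), hphi.comp hX, fun A => ?_, ?_⟩
  · exact ModulatedQueue.finite_hasEntered
      (ModulatedQueue.isCountingPath_arrivals (hJ_path ω).lam (hY.isCountingPath ω)) t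
  · rw [← MeasurableSpace.comap_process_pi, ← ModulatedQueue.comap_subtype_mk hJ_path]
    exact ModulatedQueue.condExp_preimage_ae_eq_of_indepFun (κ := κ) hX hW hXW hM hκ .of_discrete
  · exact ModulatedQueue.hasLaw_bind_of_indepFun (κ := κ) hX hW hXW hM hκ

theorem mainTheorem2 {Ω : Type*} [MeasurableSpace Ω] (P : Measure Ω) [IsProbabilityMeasure P]
    {E : Type*} [MetricSpace E] [MeasurableSpace E] [BorelSpace E]
    -- the modulating functions
    (lam kap mu : E → ℝ≥0)
    (hlam : Continuous lam) (hkap : Continuous kap) (hmu : Continuous mu)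
    -- the background process
    (J : ℝ≥0 → Ω → E) (hJ_meas : ∀ s, Measurable (J s))
    (hJ_cadlag : ∀ ω, ModulatedQueue.IsCadlag fun s => J s ω)
    -- the standard Poisson process that drives the arrivals
    (Ybar : ℝ≥0 → Ω → ℕ) (hY : ModulatedQueue.IsStandardPoissonProcess Ybar P)
    -- the standard exponential random variables that drive the service requirements
    (Zbar : ℕ → Ω → ℝ) (hZ_meas : ∀ k, Measurable (Zbar k))
    (hZ_law : ∀ k, HasLaw (Zbar k) (expMeasure 1) P) (hZ_indep : iIndepFun Zbar P)
    -- the background process, the Poisson process and the exponential sequence are independent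
    (hYZ : IndepFun (fun ω s => Ybar s ω) (fun ω k => Zbar k ω) P)
    (hJYZ : IndepFun (fun ω s => J s ω) (fun ω => (fun s => Ybar s ω, fun k => Zbar k ω)) P)
    (t : ℝ≥0) :
    let M : Ω → ℕ := fun ω =>
      ModulatedQueue.numJobs lam kap mu (fun s => J s ω) (fun s => Ybar s ω)
        (fun k => Zbar k ω) t
    let phi : Ω → ℝ≥0 := fun ω =>
      ModulatedQueue.poissonParameter lam kap mu t (fun s => J s ω)
    -- almost surely only finitely many jobs have entered by time `t`, and `M` and `phi` are
    -- random variables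
    (∀ᵐ ω ∂P, {k : ℕ | 1 ≤ k ∧
        ModulatedQueue.HasEntered lam (fun s => J s ω) (fun s => Ybar s ω) t k}.Finite) ∧
    Measurable M ∧ Measurable phi ∧
    -- given the whole background process, `M` is Poisson distributed with parameter `phi`
    (∀ A : Set ℕ, P⟦M ⁻¹' A | ⨆ s, MeasurableSpace.comap (J s) inferInstance⟧
        =ᵐ[P] fun ω => (poissonMeasure (phi ω)).real A) ∧
    -- the law of `M` is the corresponding mixture of Poisson distributions
    HasLaw M (P.bind fun ω => poissonMeasure (phi ω)) P := by
  obtain ⟨hfinite, hM⟩ := mainTheorem2_general hlam.measurable hkap.measurable hmu.measurable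
    hJ_meas (fun ω => (hJ_cadlag ω).isAdmissiblePath hlam hkap hmu) hY hZ_meas hZ_law hZ_indep
    hYZ hJYZ t
  exact ⟨.of_forall fun ω => (hfinite ω).subset fun _ hk => hk.2, hM⟩
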